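/- A numerical monoid is a submonoid $S$ of $(\mathbb N_0,+)$ with $\gcd(S)=1$. For such $S$ let $\mathcal A(S)$ be its set of atoms, i.e. the elements $a\in S\setminus\{0\}$ such that $a=b+c$ with $b,c\in S$ implies $b=0$ or $c=0$; let $m(S)$ be the smallest integer $m\ge\max\mathcal A(S)$ such that $m$ and $m-1$ lie in $S$; and let $\mathcal P_{\mathrm{fin},0}(S)$ be the restricted power monoid of $S$, that is, the monoid of all finite subsets of $S$ containing $0$, with set addition $A+B=\{a+b : a\in A,\ b\in B\}$ as operation. **Theorem 4.8.** Let $S$ be a numerical monoid. 1. If $S'$ is a numerical monoid such that $\mathcal P_{\mathrm{fin},0}(S')$ is isomorphic (as a monoid) to $\mathcal P_{\mathrm{fin},0}(S)$, then $|\mathcal A(S)|=|\mathcal A(S')|$ and $m(S)=m(S')$. 2. There are only finitely many numerical monoids $S'$ such that $\mathcal P_{\mathrm{fin},0}(S')$ is isomorphic to $\mathcal P_{\mathrm{fin},0}(S)$. -/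

import Mathlib

open scoped Pointwise

/-- A numerical monoid is a submonoid of `(ℕ, +)` whose greatest common divisor is `1`. -/
def IsNumericalMonoid (S : AddSubmonoid ℕ) : Prop :=
  Nat.setGcd (S : Set ℕ) = 1

/-- The set `𝒜(S)` of atoms (irreducible elements) of the monoid `S`. -/
def atomSet (S : AddSubmonoid ℕ) : Set ℕ :=
  {a | ∃ h : a ∈ S, AddIrreducible (⟨a, h⟩ : S)}

/-- The set of integers `m ≥ max 𝒜(S)` such that `m` and `m - 1 = k` lie in `S`. -/
def mCandidates (S : AddSubmonoid ℕ) : Set ℕ :=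
  {m | (∀ a ∈ atomSet S, a ≤ m) ∧ m ∈ S ∧ ∃ k ∈ S, k + 1 = m}

/-- For a numerical monoid the set defining `m(S)` is nonempty. -/
theorem mCandidates_nonempty {S : AddSubmonoid ℕ} (hS : IsNumericalMonoid S) :
    (mCandidates S).Nonempty := by
  obtain ⟨N, hN⟩ := Nat.exists_mem_closure_of_ge (S : Set ℕ)
  have hmem : ∀ m, N ≤ m → m ∈ S := by
    intro m hm
    have h := hN m hm (by rw [show Nat.setGcd (S : Set ℕ) = 1 from hS]; exact one_dvd m)
    rwa [AddSubmonoid.closure_eq] at h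
  refine ⟨2 * N + 1, ?_, hmem _ (by omega), 2 * N, hmem _ (by omega), rfl⟩
  rintro a ⟨ha, hirr⟩
  by_contra hlt
  have key := hirr.isAddUnit_or_isAddUnit
    (a := ⟨N + 1, hmem _ (by omega)⟩) (b := ⟨a - (N + 1), hmem _ (by omega)⟩)
    (Subtype.ext (by simp only [AddMemClass.mk_add_mk]; omega))
  rcases key with h | h
  · have h' := Nat.isAddUnit_iff.1 (h.map S.subtype)
    simp at h'
  · have h' := Nat.isAddUnit_iff.1 (h.map S.subtype)
    simp only [AddSubmonoid.subtype_apply] at h'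
    omega

/-- The invariant `m(S)`: the smallest integer `m ≥ max 𝒜(S)` such that `m` and `m - 1`
lie in `S`. -/
noncomputable def mInv (S : AddSubmonoid ℕ) : ℕ :=
  sInf (mCandidates S)

/-- For a numerical monoid, `m(S)` really is the least element of its defining set. -/
theorem isLeast_mInv {S : AddSubmonoid ℕ} (hS : IsNumericalMonoid S) :
    IsLeast (mCandidates S) (mInv S) :=
  ⟨Nat.sInf_mem (mCandidates_nonempty hS), fun _ h => Nat.sInf_le h⟩

/-- The restricted power monoid `𝒫_{fin,0}(S)`: all finite subsets of `S` containing `0`,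
with set addition `A + B = {a + b | a ∈ A, b ∈ B}` and neutral element `{0}`. -/
def restrictedPowerMonoid (S : AddSubmonoid ℕ) : AddSubmonoid (Finset ℕ) where
  carrier := {A | 0 ∈ A ∧ (A : Set ℕ) ⊆ S}
  zero_mem' := by
    refine ⟨by simp, ?_⟩
    intro x hx
    simp only [Finset.coe_zero, Set.mem_zero] at hx
    subst hx
    exact S.zero_mem
  add_mem' := by
    rintro A B ⟨hA0, hA⟩ ⟨hB0, hB⟩
    refine ⟨Finset.mem_add.2 ⟨0, hA0, 0, hB0, rfl⟩, ?_⟩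
    intro x hx
    obtain ⟨a, ha, b, hb, rfl⟩ := Finset.mem_add.1 (Finset.mem_coe.1 hx)
    exact S.add_mem (hA ha) (hB hb)

/-! An isomorphism of restricted power monoids forces `S = S'`, which gives both claims at once. If
`X` has maximum `M`, then `k • X + {0, M} = (k + 1) • X` for some `k` (`exists_nsmul_add_pair_eq`).
Apply a homomorphism `f` and compare maxima: `max f(X) = max f({0, M})`, so `f` induces an additive
map on maxima. Such a map is multiplication by some `c` (`exists_eq_mul`). When `f` is an
isomorphism the map is onto `S'`, so `c` divides `gcd S' = 1`. -/

theorem sum_mem_card_nsmul {ι : Type*} (X : Finset ℕ) (T : Finset ι) (f : ι → ℕ)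
    (hf : ∀ i ∈ T, f i ∈ X) : ∑ i ∈ T, f i ∈ T.card • X := by
  classical
  induction T using Finset.induction_on with
  | empty => simp
  | insert a T ha ih =>
    rw [Finset.sum_insert ha, Finset.card_insert_of_notMem ha, succ_nsmul']
    exact Finset.add_mem_add (hf a (Finset.mem_insert_self a T))
      (ih fun i hi => hf i (Finset.mem_insert_of_mem hi))

theorem exists_eq_sum_of_mem_nsmul (X : Finset ℕ) (n s : ℕ) (hs : s ∈ n • X) :
    ∃ f : Fin n → ℕ, (∀ i, f i ∈ X) ∧ ∑ i, f i = s := by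
  induction n generalizing s with
  | zero =>
    refine ⟨0, fun i => i.elim0, ?_⟩
    simpa [eq_comm] using hs
  | succ n ih =>
    rw [succ_nsmul', Finset.mem_add] at hs
    obtain ⟨x, hx, t, ht, rfl⟩ := hs
    obtain ⟨f, hf, rfl⟩ := ih t ht
    exact ⟨Fin.cons x f, fun i => Fin.cases hx hf i, by simp [Fin.sum_univ_succ]⟩

/-- Pigeonhole: a long sum of elements of `X` repeats some summand `m` times. -/
theorem exists_mul_add_of_mem_nsmul (X : Finset ℕ) (n m s : ℕ) (hX : X.Nonempty)
    (hn : X.card * m ≤ n) (hs : s ∈ n • X) :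
    ∃ x ∈ X, ∃ t ∈ (n - m) • X, s = m * x + t := by
  classical
  obtain ⟨f, hf, rfl⟩ := exists_eq_sum_of_mem_nsmul X n s hs
  obtain ⟨x, hx, hcard⟩ := Finset.exists_le_card_fiber_of_mul_le_card_of_maps_to
    (s := Finset.univ) (t := X) (f := f) (n := m) (fun i _ => hf i) hX (by simpa using hn)
  obtain ⟨T, hT, hTcard⟩ := Finset.exists_subset_card_eq hcard
  refine ⟨x, hx, ∑ i ∈ Tᶜ, f i, ?_, ?_⟩
  · simpa [Finset.card_compl, hTcard] using sum_mem_card_nsmul X Tᶜ f fun i _ => hf i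
  · rw [← Finset.sum_add_sum_compl T f, Finset.sum_congr rfl
      fun i hi => (Finset.mem_filter.1 (hT hi)).2]
    simp [hTcard]

/-- For a finite `X ⊆ ℕ` with least element `0`, the multiples of `X` eventually grow by adding
only `{0, max X}`. -/
theorem exists_nsmul_add_pair_eq (X : Finset ℕ) (h0 : 0 ∈ X) (M : ℕ) (hM : M ∈ X)
    (hmax : ∀ x ∈ X, x ≤ M) : ∃ k : ℕ, k • X + {0, M} = (k + 1) • X := by
  have mono : ∀ {a b : ℕ}, a ≤ b → a • X ⊆ b • X := fun h =>
    Finset.nsmul_subset_nsmul_right h0 h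
  rcases Nat.eq_zero_or_pos M with rfl | hpos
  · have : X = {0} := Finset.eq_singleton_iff_unique_mem.2
      ⟨h0, fun x hx => Nat.le_zero.1 (hmax x hx)⟩
    exact ⟨0, by simp [this]⟩
  have hcard : 0 < X.card := Finset.card_pos.2 ⟨0, h0⟩
  have hle : M ≤ X.card * M := Nat.le_mul_of_pos_left M hcard
  -- With this `k`, pigeonhole finds a summand `x` occurring `M` times in any sum of `k + 1`
  -- elements.
  refine ⟨X.card * M, Finset.Subset.antisymm ?_ fun s hs => ?_⟩
  · rw [succ_nsmul]
    refine Finset.add_subset_add_left fun x hx => ?_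
    rcases Finset.mem_insert.1 hx with rfl | hx
    · exact h0
    · rwa [Finset.mem_singleton.1 hx]
  obtain ⟨x, hx, t, ht, rfl⟩ := exists_mul_add_of_mem_nsmul X _ M s ⟨0, h0⟩ (Nat.le_succ _) hs
  rcases Nat.eq_zero_or_pos x with rfl | hxpos
  · refine Finset.mem_add.2 ⟨t, mono (by omega) ht, 0, by simp, by simp⟩
  · obtain ⟨y, rfl⟩ : ∃ y, x = y + 1 := ⟨x - 1, by omega⟩
    have hyM := hmax _ hx
    -- Trade `M` copies of `x` for `x` copies of `M`; since `x ≤ M`, this uses no more summands. One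
    -- copy of `M` is split off, leaving at most `k`.
    refine Finset.mem_add.2 ⟨y * M + t, ?_, M, by simp, by ring⟩
    have hy : y * M ∈ y • X := by
      simpa using sum_mem_card_nsmul X (Finset.range y) (fun _ => M) fun _ _ => hM
    have := Finset.add_mem_add hy ht
    rw [← add_nsmul] at this
    exact mono (by omega) this

theorem sup_id_add (A B : Finset ℕ) (hA : A.Nonempty) (hB : B.Nonempty) :
    (A + B).sup id = A.sup id + B.sup id := by
  obtain ⟨a, ha, ha'⟩ := A.exists_mem_eq_sup hA id
  obtain ⟨b, hb, hb'⟩ := B.exists_mem_eq_sup hB id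
  refine le_antisymm (Finset.sup_le fun x hx => ?_) ?_
  · obtain ⟨c, hc, d, hd, rfl⟩ := Finset.mem_add.1 hx
    exact add_le_add (Finset.le_sup (f := id) hc) (Finset.le_sup (f := id) hd)
  · rw [ha', hb']
    exact Finset.le_sup (f := id) (Finset.add_mem_add ha hb)

/-- The maximum of a finite set, as a homomorphism on the restricted power monoid. -/
def maxHom (S : AddSubmonoid ℕ) : restrictedPowerMonoid S →+ ℕ where
  toFun A := (A : Finset ℕ).sup id
  map_zero' := by simp
  map_add' A B := sup_id_add A B ⟨0, A.2.1⟩ ⟨0, B.2.1⟩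

theorem maxHom_mem_coe {S : AddSubmonoid ℕ} (A : restrictedPowerMonoid S) :
    maxHom S A ∈ (A : Finset ℕ) := by
  obtain ⟨a, ha, ha'⟩ := (A : Finset ℕ).exists_mem_eq_sup ⟨0, A.2.1⟩ id
  exact (show maxHom S A = a from ha') ▸ ha

theorem maxHom_mem {S : AddSubmonoid ℕ} (A : restrictedPowerMonoid S) : maxHom S A ∈ S :=
  A.2.2 (maxHom_mem_coe A)

/-- The set `{0, a}` as an element of the restricted power monoid. -/
def zeroPair {S : AddSubmonoid ℕ} (a : S) : restrictedPowerMonoid S :=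
  ⟨{0, (a : ℕ)}, by simp, by
    intro x hx
    rcases Finset.mem_insert.1 (Finset.mem_coe.1 hx) with rfl | hx
    · exact S.zero_mem
    · exact Finset.mem_singleton.1 hx ▸ a.2⟩

theorem maxHom_zeroPair {S : AddSubmonoid ℕ} (a : S) : maxHom S (zeroPair a) = a := by
  simp [maxHom, zeroPair]

/-- Every homomorphism of restricted power monoids maps sets with equal maximum to sets with equal
maximum. -/
theorem maxHom_map_eq {S S' : AddSubmonoid ℕ}
    (f : restrictedPowerMonoid S →+ restrictedPowerMonoid S') (A : restrictedPowerMonoid S) :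
    maxHom S' (f A) = maxHom S' (f (zeroPair ⟨maxHom S A, maxHom_mem A⟩)) := by
  obtain ⟨k, hk⟩ := exists_nsmul_add_pair_eq A A.2.1 (maxHom S A) (maxHom_mem_coe A)
    fun x hx => Finset.le_sup (f := id) hx
  have h : k • A + zeroPair ⟨maxHom S A, maxHom_mem A⟩ = (k + 1) • A := Subtype.ext hk
  -- Power monoids need not be cancellative, but after taking maxima `k * max f(A)` cancels in `ℕ`.
  have := congrArg (fun B => maxHom S' (f B)) h
  simp only [map_add, map_nsmul, succ_nsmul] at this
  exact (add_left_cancel this).symm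

/-- The homomorphism of numerical monoids induced on maxima by a homomorphism of restricted power
monoids. -/
def inducedHom {S S' : AddSubmonoid ℕ}
    (f : restrictedPowerMonoid S →+ restrictedPowerMonoid S') : S →+ ℕ where
  toFun a := maxHom S' (f (zeroPair a))
  map_zero' := by
    have : zeroPair (0 : S) = 0 := Subtype.ext (Finset.pair_eq_singleton 0)
    simp [this]
  map_add' a b := by
    rw [← map_add, ← map_add, maxHom_map_eq f (zeroPair a + zeroPair b)]
    congr 3
    exact Subtype.ext (by simp [maxHom_zeroPair])

/-- Both sides equal `g` at the product `ab`, read as `a` copies of `b` or `b` copies of `a`. -/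
theorem mul_map_comm {S : AddSubmonoid ℕ} (g : S →+ ℕ) (a b : S) :
    (a : ℕ) * g b = b * g a := by
  have h : (a : ℕ) • b = (b : ℕ) • a := Subtype.ext (by simp [mul_comm])
  simpa using congrArg g h

theorem exists_forall_ge_mem {S : AddSubmonoid ℕ} (hS : IsNumericalMonoid S) :
    ∃ N, ∀ m, N ≤ m → m ∈ S := by
  obtain ⟨N, hN⟩ := Nat.exists_mem_closure_of_ge (S : Set ℕ)
  refine ⟨N, fun m hm => ?_⟩
  have h := hN m hm (by rw [show Nat.setGcd (S : Set ℕ) = 1 from hS]; exact one_dvd m)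
  rwa [AddSubmonoid.closure_eq] at h

/-- Every homomorphism from a numerical monoid to `ℕ` is multiplication by a constant. -/
theorem exists_eq_mul {S : AddSubmonoid ℕ} (hS : IsNumericalMonoid S) (g : S →+ ℕ) :
    ∃ c, ∀ a, g a = c * a := by
  obtain ⟨N, hN⟩ := exists_forall_ge_mem hS
  let u : S := ⟨N + 1, hN _ (by omega)⟩
  let v : S := ⟨N + 2, hN _ (by omega)⟩
  have huv : (N + 1) * g v = (N + 2) * g u := mul_map_comm g u v
  -- As `v = u + 1`, this is the value at `1` of the extension of `g` to `ℤ`. Truncated subtraction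
  -- is harmless: `g v ≤ g u` forces both to vanish.
  refine ⟨g v - g u, fun a => ?_⟩
  have hu : g u = (N + 1) * (g v - g u) := by
    rcases le_total (g u) (g v) with h | h
    · obtain ⟨d, hd⟩ := Nat.exists_eq_add_of_le h
      rw [hd] at huv ⊢
      simp only [add_tsub_cancel_left]
      linarith
    · have : g u = 0 := by nlinarith
      have : g v = 0 := by omega
      simp [*]
  have ha : (N + 1) * g a = a * g u := mul_map_comm g u a
  refine Nat.eq_of_mul_eq_mul_left (Nat.succ_pos N) ?_
  rw [Nat.succ_eq_add_one, ha]
  conv_lhs => rw [hu]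
  ring

/-- A numerical monoid is determined by its restricted power monoid. -/
theorem eq_of_restrictedPowerMonoid_equiv {S S' : AddSubmonoid ℕ} (hS : IsNumericalMonoid S)
    (hS' : IsNumericalMonoid S') (f : restrictedPowerMonoid S ≃+ restrictedPowerMonoid S') :
    S = S' := by
  let g := inducedHom f.toAddMonoidHom
  have hsurj : ∀ b ∈ S', ∃ a, g a = b := fun b hb => by
    -- The preimage of `{0, b}` need not be a pair; only its maximum matters.
    refine ⟨⟨maxHom S (f.symm (zeroPair ⟨b, hb⟩)), maxHom_mem _⟩, ?_⟩
    refine (maxHom_map_eq f.toAddMonoidHom _).symm.trans ?_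
    simpa using maxHom_zeroPair (⟨b, hb⟩ : S')
  obtain ⟨c, hc⟩ := exists_eq_mul hS g
  have hdvd : c ∣ Nat.setGcd (S' : Set ℕ) := Nat.dvd_setGcd_iff.2 fun b hb => by
    obtain ⟨a, rfl⟩ := hsurj b hb
    exact ⟨a, hc a⟩
  obtain rfl : c = 1 := Nat.dvd_one.1 (hdvd.trans (dvd_of_eq hS'))
  ext x
  constructor
  · intro hx
    have h : g ⟨x, hx⟩ ∈ S' := maxHom_mem _
    simpa [hc] using h
  · intro hx
    obtain ⟨a, rfl⟩ := hsurj x hx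
    simp [hc]

theorem theorem4p8 (S : AddSubmonoid ℕ) (hS : IsNumericalMonoid S) :
    (∀ S' : AddSubmonoid ℕ, IsNumericalMonoid S' →
      Nonempty (restrictedPowerMonoid S' ≃+ restrictedPowerMonoid S) →
        (atomSet S).encard = (atomSet S').encard ∧ mInv S = mInv S') ∧
    {S' : AddSubmonoid ℕ | IsNumericalMonoid S' ∧
      Nonempty (restrictedPowerMonoid S' ≃+ restrictedPowerMonoid S)}.Finite := by
  constructor
  · rintro S' hS' ⟨f⟩
    obtain rfl := eq_of_restrictedPowerMonoid_equiv hS' hS f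
    exact ⟨rfl, rfl⟩
  · refine (Set.finite_singleton S).subset ?_
    rintro S' ⟨hS', ⟨f⟩⟩
    exact eq_of_restrictedPowerMonoid_equiv hS' hS f
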